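/- Let $\mathbb{R}^3$ carry its Euclidean metric $g$, with orthonormal basis $e_1,e_2,e_3$. Let $\mu$ be the left Maurer–Cartan form of $SU(2)$, let $\omega(A,B)=[\mu(A),\mu(B)]$, and equip $\mathfrak{su}(2)$ with the invariant inner product for which $i\tau_1,i\tau_2,i\tau_3$ are orthonormal ($\tau_a$ the Pauli matrices), so that $SU(2)$ is the round unit sphere $S^3$. For a smooth map $\varphi:\mathbb{R}^3\to SU(2)$ the Skyrme term is $$E_4(\varphi)=\tfrac12\|\varphi^*\omega\|_{L^2}^2=\tfrac12\int_{\mathbb{R}^3}\sum_{i<j}|\varphi^*\omega(e_i,e_j)|^2\,dx\in[0,\infty].$$ Let $\mathrm{SDiff}$ be the group of volume preserving diffeomorphisms $\psi$ of $\mathbb{R}^3$ with compact support (the closure of $\{x:\psi(x)\ne x\}$ is compact), and let $\Gamma_0$ be the space of smooth divergenceless vector fields of compact support on $\mathbb{R}^3$. By a smooth curve or two-parameter variation in $\mathrm{SDiff}$ through $\mathrm{id}$ we mean a family $\psi_p$ with $\psi_0=\mathrm{id}$ such that, for parameters $p$ near $0$, $\psi_p(x)$ is jointly smooth in $(p,x)$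 and the supports of the $\psi_p$ lie in a common compact set. A smooth map $\varphi$ is restricted $E_4$-critical if $E_4(\varphi)<\infty$ and $\frac{d}{dt}\big|_{t=0}E_4(\varphi\circ\psi_t)=0$ for all smooth curves $\psi_t$ in $\mathrm{SDiff}$ through $\psi_0=\mathrm{id}$. The hessian of $E_4$ at such a $\varphi$ is the bilinear form on $\Gamma_0$ $$\mathsf{Hess}_{E_4}(X,Y)=\frac{\partial^2E_4(\varphi\circ\psi_{s,t})}{\partial s\,\partial t}\bigg|_{s=t=0},$$ where $\psi_{s,t}$ is any two-parameter variation of $\mathrm{id}$ in $\mathrm{SDiff}$ with $\partial_s\psi_{s,t}|_{s=t=0}=X$ and $\partial_t\psi_{s,t}|_{s=t=0}=Y$. The map $\varphi$ is restricted $E_4$-stable if it is restricted $E_4$-critical and $\mathsf{Hess}_{E_4}(X,X)\ge0$ for all $X\in\Gamma_0$. **Proposition.** Let $\varphi:\mathbb{R}^3\to S^3=SU(2)$ be inverse stereographic projection, $$\varphi(x)=\frac{|x|^2-1}{|x|^2+1}\,\mathbb{I}_2+\frac{2i}{|x|^2+1}\,x\cdot\tau,$$ that is, $\varphi(rn)=\cos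 f(r)\,\mathbb{I}_2+i\sin f(r)\,n\cdot\tau$ for $r\ge0$, $|n|=1$, with $f(r)=2\cot^{-1}r$. Then $\varphi$ is restricted $E_4$-stable. In fact its hessian (a well-defined bilinear form) satisfies, for all $X\in\Gamma_0$, $$\mathsf{Hess}_{E_4}(X,X)=2\,\|f'(r)^2\,\mathcal{L}_Xg\|_{L^2}^2\ge0,$$ where $\mathcal{L}_Xg$ is the Lie derivative of the metric, $\|\alpha\|_{L^2}^2=\int_{\mathbb{R}^3}\sum_{i,j}\alpha(e_i,e_j)^2\,dx$ for a $(0,2)$ tensor $\alpha$, and $r=|x|$. -/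

import Mathlib

open MeasureTheory Set Filter Topology
open scoped ContDiff Manifold ENNReal Matrix

noncomputable section

namespace Skyrme

/-- Physical space `ℝ³` with its Euclidean metric. -/
abbrev R3 : Type := EuclideanSpace ℝ (Fin 3)

/-- The standard (orthonormal, positively oriented) basis vectors of `ℝ³`. -/
def e (i : Fin 3) : R3 := EuclideanSpace.single i 1

/-- Complex `2 × 2` matrices, the ambient space of `SU(2)` and of its tangent spaces. -/
abbrev Mat2 : Type := Matrix (Fin 2) (Fin 2) ℂ

/-- The target group `SU(2)`. -/
abbrev SU2 : Type := Matrix.specialUnitaryGroup (Fin 2) ℂ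

/-! ### Differential geometry of `SU(2)` and of maps into it -/

/-- A map `ℝ³ → SU(2)` is smooth if it is smooth as a map into the space of matrices, of which
`SU(2)` is an embedded submanifold. -/
def IsSmoothMap (φ : R3 → SU2) : Prop :=
  ∀ i j, ContDiff ℝ ∞ (fun x => (φ x : Mat2) i j)

/-- The differential `dφ_x v`, a vector of `T_{φ(x)} SU(2) ⊆ M₂(ℂ)`, computed entrywise. -/
def differential (φ : R3 → SU2) (x v : R3) : Mat2 :=
  Matrix.of fun i j => fderiv ℝ (fun y => (φ y : Mat2) i j) x v

/-- The left Maurer-Cartan form `μ_U(A) = U⁻¹ A` on tangent vectors `A ∈ T_U SU(2)`. -/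
def maurerCartan (U : SU2) (A : Mat2) : Mat2 := ((U⁻¹ : SU2) : Mat2) * A

/-- The `su(2)`-valued two-form `ω(A, B) = [μ(A), μ(B)]` on `SU(2)`. -/
def omega (U : SU2) (A B : Mat2) : Mat2 := ⁅maurerCartan U A, maurerCartan U B⁆

/-- The pullback `φ^*ω`. -/
def pullbackOmega (φ : R3 → SU2) (x v w : R3) : Mat2 :=
  omega (φ x) (differential φ x v) (differential φ x w)

/-- The squared norm of `A ∈ su(2)` for the invariant inner product `⟨A, B⟩ = ½ Re tr (Aᴴ B)`, for
which `iτ₁, iτ₂, iτ₃` are orthonormal. The bi-invariant metric it induces on `SU(2)` is the round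
metric of the unit sphere `S³`. -/
def suNormSq (A : Mat2) : ℝ := (1 / 2) * (Matrix.trace (Aᴴ * A)).re

/-- The squared norm `|φ^*ω|² = ∑_{i<j} |φ^*ω(e_i, e_j)|²` of the two-form `φ^*ω` at `x`. -/
def omegaNormSq (φ : R3 → SU2) (x : R3) : ℝ :=
  ∑ i : Fin 3, ∑ j ∈ Finset.Ioi i, suNormSq (pullbackOmega φ x (e i) (e j))

/-- The Skyrme term `E₄(φ) = ½ ‖φ^*ω‖²_{L²} ∈ [0, ∞]`. -/
def E4 (φ : R3 → SU2) : ℝ≥0∞ :=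
  (1 / 2) * ∫⁻ x, ENNReal.ofReal (omegaNormSq φ x)

/-! ### Volume preserving diffeomorphisms and their variations -/

/-- Volume preserving diffeomorphisms of `ℝ³` with compact support. -/
structure SDiff where
  /-- the underlying diffeomorphism -/
  toDiffeo : R3 ≃ₘ^∞⟮𝓘(ℝ, R3), 𝓘(ℝ, R3)⟯ R3
  volume_preserving : ∀ x, (fderiv ℝ (toDiffeo : R3 → R3) x).det = 1
  compact_support : IsCompact (closure {x | toDiffeo x ≠ x})

instance : CoeFun SDiff (fun _ => R3 → R3) := ⟨fun ψ => ψ.toDiffeo⟩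

/-- The space `Γ₀` of smooth divergenceless vector fields of compact support on `ℝ³`. -/
def Gamma0 : Submodule ℝ (R3 → R3) where
  carrier := {X | ContDiff ℝ ∞ X ∧ HasCompactSupport X ∧ ∀ x, ∑ i, fderiv ℝ X x (e i) i = 0}
  zero_mem' := ⟨contDiff_const, HasCompactSupport.zero, fun x => by
    simp [show (0 : R3 → R3) = fun _ => 0 from rfl]⟩
  add_mem' := by
    rintro X Y ⟨hX, hXc, hXd⟩ ⟨hY, hYc, hYd⟩
    refine ⟨hX.add hY, hXc.add hYc, fun x => ?_⟩
    rw [fderiv_add (hX.differentiable (by simp) x) (hY.differentiable (by simp) x)]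
    simp [Finset.sum_add_distrib, hXd x, hYd x]
  smul_mem' := by
    rintro c X ⟨hX, hXc, hXd⟩
    refine ⟨hX.const_smul c, hXc.smul_left (f := fun _ => c), fun x => ?_⟩
    rw [fderiv_const_smul (hX.differentiable (by simp) x)]
    simp [← Finset.mul_sum, hXd x]

/-- A smooth variation of `id` in `SDiff`, with parameters `p` in a normed space `P` (`P = ℝ` for
curves, `P = ℝ × ℝ` for two-parameter variations): `ψ_0 = id` and, for `p` near `0`, `ψ_p(x)` is
jointly smooth in `(p, x)` and the supports lie in a common compact set (the usual meaning of
smoothness for a family of compactly supported diffeomorphisms). -/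
def IsVariation {P : Type} [NormedAddCommGroup P] [NormedSpace ℝ P] (ψ : P → SDiff) : Prop :=
  (∀ x, ψ 0 x = x) ∧
  ∃ U : Set P, IsOpen U ∧ (0 : P) ∈ U ∧
    ContDiffOn ℝ ∞ (fun q : P × R3 => ψ q.1 q.2) (U ×ˢ univ) ∧
    ∃ K : Set R3, IsCompact K ∧ ∀ p ∈ U, ∀ x ∉ K, ψ p x = x

/-- `φ` is restricted `F`-critical: it is smooth, `F(φ)` is finite, and
`d/dt F(φ ∘ ψ_t) = 0` at `t = 0` for all smooth curves `ψ_t` in `SDiff` through `ψ_0 = id`. -/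
def IsRestrictedCritical (F : (R3 → SU2) → ℝ≥0∞) (φ : R3 → SU2) : Prop :=
  IsSmoothMap φ ∧ F φ ≠ ⊤ ∧
  ∀ ψ : ℝ → SDiff, IsVariation ψ →
    HasDerivAt (fun t => (F (φ ∘ ψ t)).toReal) 0 0

/-- The two-parameter variation `ψ_{s,t}` is tangent to `X, Y`: `X = ∂_s ψ_{s,t}` and
`Y = ∂_t ψ_{s,t}` at `s = t = 0`. -/
def IsTangentTo (ψ : ℝ × ℝ → SDiff) (X Y : R3 → R3) : Prop :=
  ∀ x, HasDerivAt (fun s => ψ (s, 0) x) (X x) 0 ∧ HasDerivAt (fun t => ψ (0, t) x) (Y x) 0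

/-- The bilinear form `H` on `Γ₀` is the hessian of `F` at `φ`: for every two-parameter variation
`ψ_{s,t}` of `id` in `SDiff` tangent to `X, Y`, the derivative `∂²F(φ ∘ ψ_{s,t})/∂s∂t` at
`s = t = 0` exists and equals `H(X, Y)`. -/
def IsHessian (F : (R3 → SU2) → ℝ≥0∞) (φ : R3 → SU2) (H : LinearMap.BilinForm ℝ Gamma0) : Prop :=
  ∀ (X Y : Gamma0) (ψ : ℝ × ℝ → SDiff), IsVariation ψ → IsTangentTo ψ X Y →
    (∀ᶠ s in 𝓝 (0 : ℝ), DifferentiableAt ℝ (fun t => (F (φ ∘ ψ (s, t))).toReal) 0) ∧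
    HasDerivAt (fun s => deriv (fun t => (F (φ ∘ ψ (s, t))).toReal) 0) (H X Y) 0

/-- `φ` is restricted `F`-stable: it is restricted `F`-critical and the hessian of `F` at `φ` is
non-negative. -/
def IsRestrictedStable (F : (R3 → SU2) → ℝ≥0∞) (φ : R3 → SU2) : Prop :=
  IsRestrictedCritical F φ ∧
  ∃ H : LinearMap.BilinForm ℝ Gamma0, IsHessian F φ H ∧ ∀ X, 0 ≤ H X X

/-! ### Lie derivative of the metric -/

/-- The Euclidean metric `g`, as a field of bilinear forms. -/
def metric (_x v w : R3) : ℝ := inner ℝ v w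

/-- The Lie derivative of a `(0,2)` tensor field, evaluated on vectors `v, w` (extended to constant
vector fields): `(L_X α)(v, w) = X[α(v, w)] - α([X, v], w) - α(v, [X, w])`. -/
def lieDerivative (X : R3 → R3) (α : R3 → R3 → R3 → ℝ) (x v w : R3) : ℝ :=
  fderiv ℝ (fun y => α y v w) x (X x)
    - α x (VectorField.lieBracket ℝ X (fun _ => v) x) w
    - α x v (VectorField.lieBracket ℝ X (fun _ => w) x)

/-- `‖α‖²_{L²} = ∫ ∑_{i,j} α(e_i, e_j)²` for a `(0,2)` tensor field `α`. -/
def l2NormSq (α : R3 → R3 → R3 → ℝ) : ℝ := ∫ x, ∑ i, ∑ j, α x (e i) (e j) ^ 2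

/-! ### Inverse stereographic projection -/

/-- The Pauli matrices `τ₁, τ₂, τ₃`. -/
def pauli : Fin 3 → Mat2 := ![!![0, 1; 1, 0], !![0, -Complex.I; Complex.I, 0], !![1, 0; 0, -1]]

/-- `x · τ = x₁ τ₁ + x₂ τ₂ + x₃ τ₃`. -/
def dotPauli (x : R3) : Mat2 := ∑ a, (x a : ℂ) • pauli a

/-- The matrix `φ₀ 1 + i (φ₁, φ₂, φ₃) · τ` with
`(φ₀, φ₁, φ₂, φ₃) = (r² - 1, 2 x) / (r² + 1) ∈ S³`, `r = |x|`. -/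
def invStereoMatrix (x : R3) : Mat2 :=
  (((‖x‖ ^ 2 - 1) / (‖x‖ ^ 2 + 1) : ℝ) : ℂ) • (1 : Mat2)
    + (((2 / (‖x‖ ^ 2 + 1) : ℝ) : ℂ) * Complex.I) • dotPauli x

theorem invStereoMatrix_mem (x : R3) :
    invStereoMatrix x ∈ Matrix.specialUnitaryGroup (Fin 2) ℂ := by
  have hpos : ‖x‖ ^ 2 + 1 ≠ 0 := by positivity
  have hn : ‖x‖ ^ 2 = x 0 ^ 2 + x 1 ^ 2 + x 2 ^ 2 := by
    simp [EuclideanSpace.norm_sq_eq, Fin.sum_univ_three]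
  obtain ⟨a, ha⟩ : ∃ a : ℝ, a = (‖x‖ ^ 2 - 1) / (‖x‖ ^ 2 + 1) := ⟨_, rfl⟩
  obtain ⟨b, hb⟩ : ∃ b : ℝ, b = 2 / (‖x‖ ^ 2 + 1) := ⟨_, rfl⟩
  have key : a ^ 2 + b ^ 2 * (x 0 ^ 2 + x 1 ^ 2 + x 2 ^ 2) = 1 := by
    rw [ha, hb, ← hn]; field_simp; ring
  have hM : invStereoMatrix x = !![a + b * x 2 * Complex.I, b * (x 0 * Complex.I + x 1);
      b * (x 0 * Complex.I - x 1), a - b * x 2 * Complex.I] := by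
    unfold invStereoMatrix dotPauli
    rw [← ha, ← hb]
    ext i j
    fin_cases i <;> fin_cases j <;> simp [Fin.sum_univ_three, pauli] <;> ring_nf <;>
      simp <;> ring
  have keyC : (a : ℂ) ^ 2 + b ^ 2 * (x 0 ^ 2 + x 1 ^ 2 + x 2 ^ 2) = 1 := by exact_mod_cast key
  rw [Matrix.mem_specialUnitaryGroup_iff, Matrix.mem_unitaryGroup_iff, hM]
  constructor
  · ext i j
    fin_cases i <;> fin_cases j <;> simp [Matrix.mul_apply, Fin.sum_univ_two] <;>
      first
        | linear_combination keyC - (b : ℂ) ^ 2 * (x 0 ^ 2 + x 2 ^ 2) * Complex.I_sq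
        | ring
  · rw [Matrix.det_fin_two_of]
    linear_combination keyC - (b : ℂ) ^ 2 * (x 0 ^ 2 + x 2 ^ 2) * Complex.I_sq

/-- Inverse stereographic projection `ℝ³ → S³ = SU(2)`. -/
def invStereo (x : R3) : SU2 := ⟨invStereoMatrix x, invStereoMatrix_mem x⟩

/-- The radial profile `f(r) = 2 cot⁻¹ r` of inverse stereographic projection. -/
def profile (r : ℝ) : ℝ := Real.pi - 2 * Real.arctan r

/-- Inverse stereographic projection is the hedgehog `φ(rn) = cos f(r) 1 + i sin f(r) n · τ`
with profile `f`. -/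
theorem invStereo_eq_hedgehog (r : ℝ) (n : R3) (hr : 0 ≤ r) (hn : ‖n‖ = 1) :
    (invStereo (r • n) : Mat2) = (Real.cos (profile r) : ℂ) • (1 : Mat2)
      + ((Real.sin (profile r) : ℂ) * Complex.I) • dotPauli n := by
  have hpos : r ^ 2 + 1 ≠ 0 := by positivity
  have hnorm : ‖r • n‖ = r := by rw [norm_smul, hn, mul_one, Real.norm_of_nonneg hr]
  have hc : Real.cos (profile r) = (r ^ 2 - 1) / (r ^ 2 + 1) := by
    rw [profile, Real.cos_pi_sub, Real.cos_two_mul, Real.cos_sq_arctan]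
    field_simp; ring
  have hs : Real.sin (profile r) = 2 / (r ^ 2 + 1) * r := by
    rw [profile, Real.sin_pi_sub, Real.sin_two_mul, Real.sin_arctan, Real.cos_arctan]
    have h1 : Real.sqrt (1 + r ^ 2) ^ 2 = 1 + r ^ 2 := Real.sq_sqrt (by positivity)
    have h2 : Real.sqrt (1 + r ^ 2) ≠ 0 := by positivity
    field_simp
    rw [h1]; ring
  have hd : dotPauli (r • n) = (r : ℂ) • dotPauli n := by
    simp only [dotPauli, Finset.smul_sum, smul_smul, PiLp.smul_apply, smul_eq_mul,
      Complex.ofReal_mul]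
  rw [hc, hs]
  change invStereoMatrix (r • n) = _
  rw [invStereoMatrix, hnorm, hd, smul_smul]
  congr 2
  push_cast
  ring

end Skyrme

end

noncomputable section

namespace Skyrme

/-! Stereographic projection is conformal, so the Skyrme density of `φ ∘ ψ` at `x` is a radial
weight at `ψ x` times the sum of the squared 2×2 minors of `Dψ`. As `det Dψ = 1`, these minors are,
up to sign, the entries of `(Dψ)⁻¹`, that is, of `Dχ` at `ψ x` with `χ = ψ⁻¹`. Volume preservation
then gives `E₄(φ ∘ ψ) = 2 ∫ f'⁴ |Dχ|²` (`SDiff.E4_invStereo_comp`): the weight is fixed and only the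
unimodular matrix field `N = Dχ` varies, starting from `N = 1`.

The variation is now pointwise linear algebra. At `N = 1` the constraint `det N = 1` forces `tr N_u
= 0` and `tr N_uv = tr (N_u N_v)`. So `|N|²` has zero first derivative, and its second derivative is
`2⟨N_u, N_v⟩ + 2 tr (N_u N_v) = ⟨N_u + N_uᵀ, N_v + N_vᵀ⟩` (`fderiv_fderiv_frobSq`). Since `N_u =
-DX` (`fderiv_invJac_zero`), the symmetrized matrix is `-L_X g`, and the hessian depends on `X, Y`
alone.

The analysis needed is joint smoothness of the inverses (`contDiffAt_inv_family`) and
differentiation under the integral sign (`hasDerivAt_integral_of_contDiffAt`). -/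

/-! ### Quaternion algebra for `SU(2)` and `su(2)`. -/

/-- The matrix `a 1 + i (p, q, r) · τ` of a quaternion. -/
def quat (a p q r : ℝ) : Mat2 :=
  !![a + r * Complex.I, p * Complex.I + q; p * Complex.I - q, a - r * Complex.I]

/-- For a unit quaternion the conjugate transpose is the inverse, so this computes the Maurer-Cartan
form. The real part is the inner product of `ℝ⁴`, which vanishes on tangent vectors of the sphere.
-/
theorem quat_conjTranspose_mul (a p q r a' p' q' r' : ℝ) :
    (quat a p q r)ᴴ * quat a' p' q' r' =
      quat (a * a' + p * p' + q * q' + r * r') (a * p' - a' * p + (q * r' - r * q'))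
        (a * q' - a' * q + (r * p' - p * r')) (a * r' - a' * r + (p * q' - q * p')) := by
  have hI := Complex.I_sq
  ext i j
  fin_cases i <;> fin_cases j <;> simp [quat, Matrix.mul_apply, Fin.sum_univ_two] <;>
    ring_nf <;> simp only [hI] <;> ring

theorem lie_quat_zero (p q r p' q' r' : ℝ) :
    ⁅quat 0 p q r, quat 0 p' q' r'⁆ =
      quat 0 (-2 * (q * r' - r * q')) (-2 * (r * p' - p * r')) (-2 * (p * q' - q * p')) := by
  have hI := Complex.I_sq
  rw [Ring.lie_def]
  ext i j
  fin_cases i <;> fin_cases j <;> simp [quat] <;>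
    ring_nf <;> simp only [hI] <;> ring

theorem suNormSq_quat (a p q r : ℝ) :
    suNormSq (quat a p q r) = a ^ 2 + p ^ 2 + q ^ 2 + r ^ 2 := by
  rw [suNormSq, quat_conjTranspose_mul, Matrix.trace_fin_two]
  simp [quat]
  ring

/-- The norm of `[U⁻¹ A, U⁻¹ B]` for `A, B` tangent to the unit sphere at `U`. -/
theorem suNormSq_lie_quat {a p q r a₁ p₁ q₁ r₁ a₂ p₂ q₂ r₂ : ℝ}
    (hU : a ^ 2 + p ^ 2 + q ^ 2 + r ^ 2 = 1)
    (h₁ : a * a₁ + p * p₁ + q * q₁ + r * r₁ = 0) (h₂ : a * a₂ + p * p₂ + q * q₂ + r * r₂ = 0) :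
    suNormSq ⁅(quat a p q r)ᴴ * quat a₁ p₁ q₁ r₁, (quat a p q r)ᴴ * quat a₂ p₂ q₂ r₂⁆ =
      4 * ((a₁ ^ 2 + p₁ ^ 2 + q₁ ^ 2 + r₁ ^ 2) * (a₂ ^ 2 + p₂ ^ 2 + q₂ ^ 2 + r₂ ^ 2)
        - (a₁ * a₂ + p₁ * p₂ + q₁ * q₂ + r₁ * r₂) ^ 2) := by
  rw [quat_conjTranspose_mul, quat_conjTranspose_mul, h₁, h₂, lie_quat_zero, suNormSq_quat]
  -- Left multiplication by a unit quaternion is an isometry. With `e₁`, `e₂`, `e₃` the claim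
  -- becomes Lagrange's identity for the cross product; the factor 4 comes from the bracket being
  -- `-2` times that product.
  have e₁ : (a * p₁ - a₁ * p + (q * r₁ - r * q₁)) ^ 2 + (a * q₁ - a₁ * q + (r * p₁ - p * r₁)) ^ 2
      + (a * r₁ - a₁ * r + (p * q₁ - q * p₁)) ^ 2 = a₁ ^ 2 + p₁ ^ 2 + q₁ ^ 2 + r₁ ^ 2 := by
    linear_combination (a₁ ^ 2 + p₁ ^ 2 + q₁ ^ 2 + r₁ ^ 2) * hU
      - (a * a₁ + p * p₁ + q * q₁ + r * r₁) * h₁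
  have e₂ : (a * p₂ - a₂ * p + (q * r₂ - r * q₂)) ^ 2 + (a * q₂ - a₂ * q + (r * p₂ - p * r₂)) ^ 2
      + (a * r₂ - a₂ * r + (p * q₂ - q * p₂)) ^ 2 = a₂ ^ 2 + p₂ ^ 2 + q₂ ^ 2 + r₂ ^ 2 := by
    linear_combination (a₂ ^ 2 + p₂ ^ 2 + q₂ ^ 2 + r₂ ^ 2) * hU
      - (a * a₂ + p * p₂ + q * q₂ + r * r₂) * h₂
  have e₃ : (a * p₁ - a₁ * p + (q * r₁ - r * q₁)) * (a * p₂ - a₂ * p + (q * r₂ - r * q₂))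
      + (a * q₁ - a₁ * q + (r * p₁ - p * r₁)) * (a * q₂ - a₂ * q + (r * p₂ - p * r₂))
      + (a * r₁ - a₁ * r + (p * q₁ - q * p₁)) * (a * r₂ - a₂ * r + (p * q₂ - q * p₂))
      = a₁ * a₂ + p₁ * p₂ + q₁ * q₂ + r₁ * r₂ := by
    linear_combination (a₁ * a₂ + p₁ * p₂ + q₁ * q₂ + r₁ * r₂) * hU
      - (a * a₁ + p * p₁ + q * q₁ + r * r₁) * h₂
  rw [← e₁, ← e₂, ← e₃]
  ring

/-! ### Conformality of inverse stereographic projection. -/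

/-- Every component is polynomial in `x` and `c = (‖x‖² + 1)⁻¹`, so later identities follow from the
single relation `c (‖x‖² + 1) = 1`. -/
theorem invStereoMatrix_eq_quat (x : R3) :
    invStereoMatrix x = quat (1 - 2 * (‖x‖ ^ 2 + 1)⁻¹) (2 * (‖x‖ ^ 2 + 1)⁻¹ * x 0)
      (2 * (‖x‖ ^ 2 + 1)⁻¹ * x 1) (2 * (‖x‖ ^ 2 + 1)⁻¹ * x 2) := by
  have hpos : ‖x‖ ^ 2 + 1 ≠ 0 := by positivity
  have h1 : (‖x‖ ^ 2 - 1) / (‖x‖ ^ 2 + 1) = 1 - 2 * (‖x‖ ^ 2 + 1)⁻¹ := by field_simp; ring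
  rw [invStereoMatrix, h1, div_eq_mul_inv]
  generalize (‖x‖ ^ 2 + 1)⁻¹ = c
  have hI := Complex.I_sq
  ext i j
  fin_cases i <;> fin_cases j <;>
    simp [quat, dotPauli, Fin.sum_univ_three, pauli] <;> ring_nf <;> simp only [hI] <;> ring

theorem norm_sq_eq_coord (x : R3) : ‖x‖ ^ 2 = x 0 ^ 2 + x 1 ^ 2 + x 2 ^ 2 := by
  simp [EuclideanSpace.norm_sq_eq, Fin.sum_univ_three]

theorem inner_eq_coord (x y : R3) : inner ℝ x y = x 0 * y 0 + x 1 * y 1 + x 2 * y 2 := by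
  simp [PiLp.inner_apply, Fin.sum_univ_three, mul_comm]

theorem hasFDerivAt_inv_norm_sq_add_one (x : R3) :
    HasFDerivAt (fun y : R3 => (‖y‖ ^ 2 + 1)⁻¹)
      ((-2 * (‖x‖ ^ 2 + 1)⁻¹ ^ 2) • innerSL ℝ x) x := by
  have h := (hasDerivAt_inv (by positivity : ‖x‖ ^ 2 + 1 ≠ 0)).comp_hasFDerivAt x
    ((hasStrictFDerivAt_norm_sq x).hasFDerivAt.add_const 1)
  refine HasFDerivAt.congr_fderiv h ?_
  ext v
  simp
  ring

theorem contDiff_inv_norm_sq_add_one {n : WithTop ℕ∞} :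
    ContDiff ℝ n (fun y : R3 => (‖y‖ ^ 2 + 1)⁻¹) :=
  ((contDiff_norm_sq ℝ).add contDiff_const).inv fun x => by positivity

theorem contDiff_coord (i : Fin 3) {n : WithTop ℕ∞} : ContDiff ℝ n (fun y : R3 => y i) :=
  contDiff_euclidean.1 contDiff_id i

theorem hasFDerivAt_coord (i : Fin 3) (x : R3) :
    HasFDerivAt (fun y : R3 => y i) (EuclideanSpace.proj i : R3 →L[ℝ] ℝ) x :=
  (EuclideanSpace.proj i : R3 →L[ℝ] ℝ).hasFDerivAt

theorem contDiff_quat {a p q r : R3 → ℝ} {n : WithTop ℕ∞} (ha : ContDiff ℝ n a)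
    (hp : ContDiff ℝ n p) (hq : ContDiff ℝ n q) (hr : ContDiff ℝ n r) (i j : Fin 2) :
    ContDiff ℝ n (fun x => quat (a x) (p x) (q x) (r x) i j) := by
  have h : ∀ {f : R3 → ℝ}, ContDiff ℝ n f → ContDiff ℝ n (fun x => (f x : ℂ)) :=
    fun hf => Complex.ofRealCLM.contDiff.comp hf
  have ha := h ha
  have hp := h hp
  have hq := h hq
  have hr := h hr
  fin_cases i <;> fin_cases j <;> simp [quat] <;> fun_prop

theorem fderiv_quat {a p q r : R3 → ℝ} {a' p' q' r' : R3 →L[ℝ] ℝ} {x : R3}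
    (ha : HasFDerivAt a a' x) (hp : HasFDerivAt p p' x) (hq : HasFDerivAt q q' x)
    (hr : HasFDerivAt r r' x) (v : R3) (i j : Fin 2) :
    fderiv ℝ (fun x => quat (a x) (p x) (q x) (r x) i j) x v =
      quat (a' v) (p' v) (q' v) (r' v) i j := by
  have h : ∀ {f : R3 → ℝ} {f' : R3 →L[ℝ] ℝ}, HasFDerivAt f f' x →
      HasFDerivAt (fun x => (f x : ℂ)) (Complex.ofRealCLM.comp f') x :=
    fun hf => Complex.ofRealCLM.hasFDerivAt.comp x hf
  have ha := h ha
  have hp := h hp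
  have hq := h hq
  have hr := h hr
  fin_cases i <;> fin_cases j
  · refine (congrArg (· v) (ha.add (hr.mul_const Complex.I)).fderiv).trans ?_
    simp [quat, mul_comm]
  · refine (congrArg (· v) ((hp.mul_const Complex.I).add hq).fderiv).trans ?_
    simp [quat, mul_comm]
  · refine (congrArg (· v) ((hp.mul_const Complex.I).sub hq).fderiv).trans ?_
    simp [quat, mul_comm]
  · refine (congrArg (· v) (ha.sub (hr.mul_const Complex.I)).fderiv).trans ?_
    simp [quat, mul_comm]

theorem isSmoothMap_invStereo : IsSmoothMap invStereo := by
  intro i j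
  change ContDiff ℝ ∞ fun x => invStereoMatrix x i j
  simp only [invStereoMatrix_eq_quat]
  have h : ContDiff ℝ ∞ (fun y : R3 => (‖y‖ ^ 2 + 1)⁻¹) := contDiff_inv_norm_sq_add_one
  have hβ := contDiff_const (c := (2 : ℝ)).mul h
  exact contDiff_quat (contDiff_const.sub hβ) (hβ.mul (contDiff_coord 0)) (hβ.mul (contDiff_coord 1))
    (hβ.mul (contDiff_coord 2)) i j

theorem differential_invStereo (x v : R3) :
    differential invStereo x v =
      quat (4 * (‖x‖ ^ 2 + 1)⁻¹ ^ 2 * inner ℝ x v)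
        (2 * (‖x‖ ^ 2 + 1)⁻¹ * v 0 - 4 * (‖x‖ ^ 2 + 1)⁻¹ ^ 2 * inner ℝ x v * x 0)
        (2 * (‖x‖ ^ 2 + 1)⁻¹ * v 1 - 4 * (‖x‖ ^ 2 + 1)⁻¹ ^ 2 * inner ℝ x v * x 1)
        (2 * (‖x‖ ^ 2 + 1)⁻¹ * v 2 - 4 * (‖x‖ ^ 2 + 1)⁻¹ ^ 2 * inner ℝ x v * x 2) := by
  ext i j
  change fderiv ℝ (fun y => invStereoMatrix y i j) x v = _
  simp only [invStereoMatrix_eq_quat]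
  have hβ := (hasFDerivAt_inv_norm_sq_add_one x).const_mul 2
  refine (fderiv_quat ((hasFDerivAt_const 1 x).sub hβ) (hβ.mul (hasFDerivAt_coord 0 x))
    (hβ.mul (hasFDerivAt_coord 1 x)) (hβ.mul (hasFDerivAt_coord 2 x)) v i j).trans ?_
  congr 2
  all_goals
    simp
    try ring

theorem differential_comp {φ : R3 → SU2} (hφ : IsSmoothMap φ) {ψ : R3 → R3} {x : R3}
    (hψ : DifferentiableAt ℝ ψ x) (v : R3) :
    differential (φ ∘ ψ) x v = differential φ (ψ x) (fderiv ℝ ψ x v) := by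
  ext i j
  have h : DifferentiableAt ℝ (fun y => (φ y : Mat2) i j) (ψ x) :=
    ((hφ i j).differentiable (by simp)) _
  exact congrArg (· v) (fderiv_comp x h hψ)

/-- Inverse stereographic projection is conformal, with conformal factor `4 / (1 + |x|²)²`. -/
theorem suNormSq_omega_invStereo (x v w : R3) :
    suNormSq (omega (invStereo x) (differential invStereo x v) (differential invStereo x w)) =
      64 * (‖x‖ ^ 2 + 1)⁻¹ ^ 4 * (‖v‖ ^ 2 * ‖w‖ ^ 2 - inner ℝ v w ^ 2) := by
  have hinv : ((invStereo x)⁻¹ : SU2).1 = (invStereoMatrix x)ᴴ := rfl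
  rw [omega, maurerCartan, maurerCartan, hinv, invStereoMatrix_eq_quat, differential_invStereo,
    differential_invStereo]
  have hc : (‖x‖ ^ 2 + 1)⁻¹ * (x 0 ^ 2 + x 1 ^ 2 + x 2 ^ 2 + 1) = 1 := by
    rw [← norm_sq_eq_coord]; exact inv_mul_cancel₀ (by positivity)
  generalize (‖x‖ ^ 2 + 1)⁻¹ = c at *
  have hU : (1 - 2 * c) ^ 2 + (2 * c * x 0) ^ 2 + (2 * c * x 1) ^ 2 + (2 * c * x 2) ^ 2 = 1 := by
    linear_combination 4 * c * hc
  -- `ht` is tangency to the sphere; `hi` is conformality with factor `4 c²`.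
  have ht (u : R3) : (1 - 2 * c) * (4 * c ^ 2 * inner ℝ x u)
      + 2 * c * x 0 * (2 * c * u 0 - 4 * c ^ 2 * inner ℝ x u * x 0)
      + 2 * c * x 1 * (2 * c * u 1 - 4 * c ^ 2 * inner ℝ x u * x 1)
      + 2 * c * x 2 * (2 * c * u 2 - 4 * c ^ 2 * inner ℝ x u * x 2) = 0 := by
    rw [inner_eq_coord]
    linear_combination (-8) * c ^ 2 * (x 0 * u 0 + x 1 * u 1 + x 2 * u 2) * hc
  have hi (u u' : R3) : (4 * c ^ 2 * inner ℝ x u) * (4 * c ^ 2 * inner ℝ x u')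
      + (2 * c * u 0 - 4 * c ^ 2 * inner ℝ x u * x 0) * (2 * c * u' 0 - 4 * c ^ 2 * inner ℝ x u' * x 0)
      + (2 * c * u 1 - 4 * c ^ 2 * inner ℝ x u * x 1) * (2 * c * u' 1 - 4 * c ^ 2 * inner ℝ x u' * x 1)
      + (2 * c * u 2 - 4 * c ^ 2 * inner ℝ x u * x 2) * (2 * c * u' 2 - 4 * c ^ 2 * inner ℝ x u' * x 2)
      = 4 * c ^ 2 * inner ℝ u u' := by
    rw [inner_eq_coord, inner_eq_coord, inner_eq_coord]
    linear_combination 16 * c ^ 3 * (x 0 * u 0 + x 1 * u 1 + x 2 * u 2) *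
      (x 0 * u' 0 + x 1 * u' 1 + x 2 * u' 2) * hc
  have hn (u : R3) : (4 * c ^ 2 * inner ℝ x u) ^ 2
      + (2 * c * u 0 - 4 * c ^ 2 * inner ℝ x u * x 0) ^ 2
      + (2 * c * u 1 - 4 * c ^ 2 * inner ℝ x u * x 1) ^ 2
      + (2 * c * u 2 - 4 * c ^ 2 * inner ℝ x u * x 2) ^ 2 = 4 * c ^ 2 * ‖u‖ ^ 2 := by
    have h := hi u u
    rw [real_inner_self_eq_norm_sq] at h
    linear_combination h
  rw [suNormSq_lie_quat hU (ht v) (ht w), hn, hn, hi]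
  ring

/-! ### Jacobian matrices -/

/-- The matrix of an endomorphism of `ℝ³` in the standard basis. -/
def jac (L : R3 →L[ℝ] R3) : Matrix (Fin 3) (Fin 3) ℝ := Matrix.of fun i j => L (e j) i

theorem jac_eq_toMatrix (L : R3 →L[ℝ] R3) :
    jac L = LinearMap.toMatrix (EuclideanSpace.basisFun (Fin 3) ℝ).toBasis
      (EuclideanSpace.basisFun (Fin 3) ℝ).toBasis L.toLinearMap := by
  ext i j
  simp [jac, LinearMap.toMatrix_apply, e]

theorem det_jac (L : R3 →L[ℝ] R3) : (jac L).det = L.det := by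
  rw [jac_eq_toMatrix, LinearMap.det_toMatrix]

theorem jac_comp (L M : R3 →L[ℝ] R3) : jac (L.comp M) = jac L * jac M := by
  simp only [jac_eq_toMatrix]
  exact LinearMap.toMatrix_comp _ _ _ _ _

theorem jac_id : jac (ContinuousLinearMap.id ℝ R3) = 1 := by
  rw [jac_eq_toMatrix]
  exact LinearMap.toMatrix_id _

/-- The squared Frobenius norm of a matrix. -/
def frobSq (N : Matrix (Fin 3) (Fin 3) ℝ) : ℝ := ∑ i, ∑ j, N i j ^ 2

/-- The weight `f'(r)⁴ = 16 / (1 + r²)⁴`. -/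
def weight (x : R3) : ℝ := 16 * (‖x‖ ^ 2 + 1)⁻¹ ^ 4

/-- Each Gram determinant is `|L e_i × L e_j|²`, and these cross products are, up to sign, the rows
of the adjugate. -/
theorem frobSq_adjugate (L : R3 →L[ℝ] R3) :
    ∑ i : Fin 3, ∑ j ∈ Finset.Ioi i,
      (‖L (e i)‖ ^ 2 * ‖L (e j)‖ ^ 2 - inner ℝ (L (e i)) (L (e j)) ^ 2) =
      frobSq (jac L).adjugate := by
  have h0 : Finset.Ioi (0 : Fin 3) = {1, 2} := by decide
  have h1 : Finset.Ioi (1 : Fin 3) = {2} := by decide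
  have h2 : Finset.Ioi (2 : Fin 3) = ∅ := by decide
  simp only [Matrix.adjugate_fin_three, frobSq, Fin.sum_univ_three, h0, h1, h2, norm_sq_eq_coord,
    inner_eq_coord, Finset.sum_singleton, Finset.sum_empty,
    Finset.sum_pair (show (1 : Fin 3) ≠ 2 by decide)]
  simp [jac]
  ring

/-- A unimodular matrix has its adjugate as inverse, so the 2×2 minors of `Dψ` turn into first
derivatives of the inverse map `χ`. -/
theorem omegaNormSq_invStereo_comp {ψ χ : R3 → R3} (hψ : Differentiable ℝ ψ)
    (hχ : Differentiable ℝ χ) (hχψ : ∀ x, χ (ψ x) = x) (hdet : ∀ x, (fderiv ℝ ψ x).det = 1)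
    (x : R3) :
    omegaNormSq (invStereo ∘ ψ) x =
      4 * (weight (ψ x) * frobSq (jac (fderiv ℝ χ (ψ x)))) := by
  have h1 : jac (fderiv ℝ χ (ψ x)) * jac (fderiv ℝ ψ x) = 1 := by
    rw [← jac_comp, ← fderiv_comp x (hχ _) (hψ x), show χ ∘ ψ = id from funext hχψ, fderiv_id,
      jac_id]
  have h2 : jac (fderiv ℝ χ (ψ x)) = (jac (fderiv ℝ ψ x)).adjugate := by
    have h3 := Matrix.mul_adjugate (jac (fderiv ℝ ψ x))
    rw [det_jac, hdet, one_smul] at h3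
    exact left_inv_eq_right_inv h1 h3
  rw [h2, ← frobSq_adjugate, omegaNormSq]
  simp only [pullbackOmega, differential_comp isSmoothMap_invStereo (hψ x), Finset.mul_sum]
  refine Finset.sum_congr rfl fun i _ => Finset.sum_congr rfl fun j _ => ?_
  rw [show (invStereo ∘ ψ) x = invStereo (ψ x) from rfl, suNormSq_omega_invStereo, weight]
  ring

theorem contDiff_weight {n : WithTop ℕ∞} : ContDiff ℝ n weight :=
  contDiff_const.mul (contDiff_inv_norm_sq_add_one.pow 4)

theorem weight_nonneg (x : R3) : 0 ≤ weight x := by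
  unfold weight; positivity

theorem integrable_weight : Integrable weight := by
  -- The weight decays like `r⁻⁸`, and `8 > 3 = dim ℝ³`.
  have h := (integrable_rpow_neg_one_add_norm_sq (E := R3) (μ := volume) (r := 8)
    (by simp; norm_num)).const_mul 16
  refine h.congr (Eventually.of_forall fun x => ?_)
  have h4 : (-8 / 2 : ℝ) = -((4 : ℕ) : ℝ) := by norm_num
  simp only [weight]
  rw [h4, Real.rpow_neg (by positivity), Real.rpow_natCast, inv_pow, add_comm]

theorem frobSq_nonneg (N : Matrix (Fin 3) (Fin 3) ℝ) : 0 ≤ frobSq N :=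
  Finset.sum_nonneg fun _ _ => Finset.sum_nonneg fun _ _ => sq_nonneg _

theorem frobSq_one : frobSq 1 = 3 := by
  simp [frobSq, Fin.sum_univ_three]
  norm_num

theorem fderiv_eq_id_of_forall_notMem {χ : R3 → R3} {K : Set R3} (hK : IsClosed K)
    (h : ∀ x ∉ K, χ x = x) {x : R3} (hx : x ∉ K) :
    fderiv ℝ χ x = ContinuousLinearMap.id ℝ R3 := by
  have : χ =ᶠ[𝓝 x] id := by
    filter_upwards [hK.isOpen_compl.mem_nhds hx] with y hy using h y hy
  rw [this.fderiv_eq, fderiv_id]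

/-! ### The energy as a weighted Dirichlet integral of the inverse diffeomorphism. -/

namespace SDiff

variable (ψ : SDiff)

/-- The inverse of a compactly supported volume preserving diffeomorphism. -/
def inv : R3 → R3 := ψ.toDiffeo.symm

theorem contDiff : ContDiff ℝ ∞ ψ := ψ.toDiffeo.contDiff

theorem contDiff_inv : ContDiff ℝ ∞ ψ.inv := ψ.toDiffeo.symm.contDiff

theorem inv_apply (x : R3) : ψ.inv (ψ x) = x := ψ.toDiffeo.symm_apply_apply x

theorem apply_inv (x : R3) : ψ (ψ.inv x) = x := ψ.toDiffeo.apply_symm_apply x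

theorem inv_eq_self {x : R3} (h : ψ x = x) : ψ.inv x = x := by
  conv_lhs => rw [← h]
  exact ψ.inv_apply x

theorem det_jac_inv (x : R3) : (jac (fderiv ℝ ψ.inv x)).det = 1 := by
  have h : jac (fderiv ℝ ψ (ψ.inv x)) * jac (fderiv ℝ ψ.inv x) = 1 := by
    rw [← jac_comp, ← fderiv_comp x (ψ.contDiff.differentiable (by simp) _)
      (ψ.contDiff_inv.differentiable (by simp) x),
      show (ψ : R3 → R3) ∘ ψ.inv = id from funext ψ.apply_inv, fderiv_id, jac_id]
  have h' := congrArg Matrix.det h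
  rwa [Matrix.det_mul, det_jac, ψ.volume_preserving, one_mul, Matrix.det_one] at h'

theorem continuous_frobSq_inv : Continuous fun x => frobSq (jac (fderiv ℝ ψ.inv x)) := by
  have h : Continuous (fderiv ℝ ψ.inv) := ψ.contDiff_inv.continuous_fderiv (by simp)
  simp only [frobSq, jac, Matrix.of_apply]
  fun_prop

/-- Subtracting `3 = |1|²` removes the contribution of the identity off the support of `ψ`, leaving
a continuous, compactly supported integrand. -/
theorem integrable_weight_mul_frobSq_sub :
    Integrable fun x => weight x * (frobSq (jac (fderiv ℝ ψ.inv x)) - 3) := by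
  refine Continuous.integrable_of_hasCompactSupport ?_
    (HasCompactSupport.intro ψ.compact_support fun x hx => ?_)
  · exact (contDiff_weight (n := 0)).continuous.mul (ψ.continuous_frobSq_inv.sub continuous_const)
  · have h (y) (hy : y ∉ closure {x | ψ x ≠ x}) : ψ.inv y = y := by
      refine ψ.inv_eq_self ?_
      by_contra hne
      exact hy (subset_closure hne)
    rw [fderiv_eq_id_of_forall_notMem isClosed_closure h hx, jac_id, frobSq_one, sub_self, mul_zero]

theorem integrable_weight_mul_frobSq :
    Integrable fun x => weight x * frobSq (jac (fderiv ℝ ψ.inv x)) := by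
  refine (ψ.integrable_weight_mul_frobSq_sub.add (integrable_weight.mul_const 3)).congr
    (Eventually.of_forall fun x => ?_)
  simp only [Pi.add_apply]
  ring

theorem lintegral_comp (g : R3 → ℝ≥0∞) : ∫⁻ x, g (ψ x) = ∫⁻ y, g y := by
  have h := lintegral_image_eq_lintegral_abs_det_fderiv_mul volume MeasurableSet.univ
    (f := ψ) (f' := fderiv ℝ ψ)
    (fun x _ => ((ψ.contDiff.differentiable (by simp) x).hasFDerivAt).hasFDerivWithinAt)
    ψ.toDiffeo.injective.injOn g
  rw [image_univ, (show Function.Surjective ψ from ψ.toDiffeo.surjective).range_eq] at h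
  simpa [ψ.volume_preserving] using h.symm

/-- After the change of variables `y = ψ x` the weight no longer depends on `ψ`, so no derivative of
it enters the variations. -/
theorem E4_invStereo_comp : E4 (invStereo ∘ ψ) =
    ENNReal.ofReal (2 * ∫ x, weight x * frobSq (jac (fderiv ℝ ψ.inv x))) := by
  have h0 (x) : 0 ≤ weight x * frobSq (jac (fderiv ℝ ψ.inv x)) :=
    mul_nonneg (weight_nonneg x) (frobSq_nonneg _)
  have h1 (x) := omegaNormSq_invStereo_comp (ψ.contDiff.differentiable (by simp))
    (ψ.contDiff_inv.differentiable (by simp)) ψ.inv_apply ψ.volume_preserving x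
  simp only [E4, h1]
  rw [ψ.lintegral_comp fun y => ENNReal.ofReal (4 * (weight y * frobSq (jac (fderiv ℝ ψ.inv y)))),
    ← ofReal_integral_eq_lintegral_ofReal (ψ.integrable_weight_mul_frobSq.const_mul 4)
      (Eventually.of_forall fun x => mul_nonneg (by norm_num) (h0 x)), integral_const_mul,
    show (1 / 2 : ℝ≥0∞) = ENNReal.ofReal (1 / 2) by
      rw [ENNReal.ofReal_div_of_pos (by norm_num)]; simp,
    ← ENNReal.ofReal_mul (by norm_num)]
  congr 1
  ring

theorem toReal_E4_invStereo_comp : (E4 (invStereo ∘ ψ)).toReal =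
    6 * (∫ x, weight x) + 2 * ∫ x, weight x * (frobSq (jac (fderiv ℝ ψ.inv x)) - 3) := by
  rw [ψ.E4_invStereo_comp, ENNReal.toReal_ofReal (mul_nonneg (by norm_num) (integral_nonneg
    fun x => mul_nonneg (weight_nonneg x) (frobSq_nonneg _)))]
  have h : ∫ x, weight x * frobSq (jac (fderiv ℝ ψ.inv x)) =
      ∫ x, (weight x * (frobSq (jac (fderiv ℝ ψ.inv x)) - 3) + weight x * 3) := by
    congr 1; ext x; ring
  rw [h, integral_add ψ.integrable_weight_mul_frobSq_sub (integrable_weight.mul_const 3),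
    integral_mul_const]
  ring

end SDiff

theorem E4_invStereo_ne_top : E4 invStereo ≠ ⊤ := by
  have hid : (⇑(Diffeomorph.refl 𝓘(ℝ, R3) R3 ∞) : R3 → R3) = id := rfl
  -- Finiteness is the energy formula applied to the identity diffeomorphism.
  let ψ : SDiff := ⟨Diffeomorph.refl 𝓘(ℝ, R3) R3 ∞,
    fun x => by rw [hid, fderiv_id]; simp [ContinuousLinearMap.det], by simp [hid]⟩
  have h : invStereo ∘ ψ = invStereo := rfl
  rw [← h, ψ.E4_invStereo_comp]
  exact ENNReal.ofReal_ne_top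

/-! ### Differentiation under the integral sign -/

section Parametric

variable {P : Type*} [NormedAddCommGroup P] [NormedSpace ℝ P]

/-- Differentiating in the parameter preserves vanishing off `K`, so differentiation under the
integral sign can be iterated. -/
theorem fderiv_apply_eq_zero_of_notMem {U : Set P} (hU : IsOpen U) {K : Set R3} {G : P × R3 → ℝ}
    (hG : ∀ p ∈ U, ∀ x, DifferentiableAt ℝ G (p, x)) (hGK : ∀ p ∈ U, ∀ x ∉ K, G (p, x) = 0)
    {p : P} (hp : p ∈ U) (v : P) {x : R3} (hx : x ∉ K) : fderiv ℝ G (p, x) (v, 0) = 0 := by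
  have h1 : HasFDerivAt (fun p => G (p, x)) ((fderiv ℝ G (p, x)).comp (.inl ℝ P R3)) p :=
    (hG p hp x).hasFDerivAt.comp p (hasFDerivAt_prodMk_left p x)
  have h2 : HasFDerivAt (fun p => G (p, x)) (0 : P →L[ℝ] ℝ) p := by
    refine (hasFDerivAt_const (0 : ℝ) p).congr_of_eventuallyEq ?_
    filter_upwards [hU.mem_nhds hp] with q hq using hGK q hq x hx
  simpa using congrArg (· v) (h1.unique h2)

theorem hasDerivAt_integral_of_contDiffAt {U : Set P} (hU : IsOpen U) {K : Set R3}
    (hK : IsCompact K) {G : P × R3 → ℝ} (hG : ∀ p ∈ U, ∀ x, ContDiffAt ℝ 1 G (p, x))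
    (hGK : ∀ p ∈ U, ∀ x ∉ K, G (p, x) = 0) {p : P} (hp : p ∈ U) (v : P) :
    HasDerivAt (fun t : ℝ => ∫ x, G (p + t • v, x)) (∫ x, fderiv ℝ G (p, x) (v, 0)) 0 := by
  have hline : Continuous fun t : ℝ => p + t • v := by fun_prop
  obtain ⟨ε, hε, hball⟩ : ∃ ε > 0, ∀ t ∈ Metric.closedBall (0 : ℝ) ε, p + t • v ∈ U := by
    have : (fun t : ℝ => p + t • v) ⁻¹' U ∈ 𝓝 (0 : ℝ) :=
      hline.continuousAt.preimage_mem_nhds (hU.mem_nhds (by simpa using hp))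
    obtain ⟨ε, hε, h⟩ := Metric.nhds_basis_closedBall.mem_iff.1 this
    exact ⟨ε, hε, fun t ht => h ht⟩
  have hd (t : ℝ) (ht : t ∈ Metric.closedBall (0 : ℝ) ε) (x : R3) :
      HasDerivAt (fun t : ℝ => G (p + t • v, x)) (fderiv ℝ G (p + t • v, x) (v, 0)) t := by
    have h1 : HasDerivAt (fun t : ℝ => (p + t • v, x)) ((v, 0) : P × R3) t := by
      have := ((hasDerivAt_id t).smul_const v).const_add p
      simp only [one_smul] at this
      exact this.prodMk (hasDerivAt_const t x)
    exact ((hG _ (hball t ht) x).differentiableAt (by simp)).hasFDerivAt.comp_hasDerivAt t h1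
  have hcont (t : ℝ) (ht : t ∈ Metric.closedBall (0 : ℝ) ε) : Continuous fun x => G (p + t • v, x) :=
    continuous_iff_continuousAt.2 fun x => (hG _ (hball t ht) x).continuousAt.comp
      (f := fun x => (p + t • v, x)) (by fun_prop)
  have hcont' : ContinuousOn (fun q : ℝ × R3 => fderiv ℝ G (p + q.1 • v, q.2) (v, 0))
      (Metric.closedBall (0 : ℝ) ε ×ˢ univ) := by
    intro q hq
    have h1 : ContinuousAt (fderiv ℝ G) (p + q.1 • v, q.2) :=
      ((hG _ (hball _ hq.1) q.2).fderiv_right (m := 0) (by simp)).continuousAt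
    have h2 := h1.comp (f := fun q : ℝ × R3 => (p + q.1 • v, q.2)) (x := q) (by fun_prop)
    exact (h2.clm_apply continuousAt_const).continuousWithinAt
  have hzero : (0 : ℝ) ∈ Metric.closedBall (0 : ℝ) ε := Metric.mem_closedBall_self hε.le
  have hvanish (t : ℝ) (ht : t ∈ Metric.ball (0 : ℝ) ε) (x : R3) (hx : x ∉ K) :
      fderiv ℝ G (p + t • v, x) (v, 0) = 0 :=
    fderiv_apply_eq_zero_of_notMem hU (fun p hp x => (hG p hp x).differentiableAt (by simp)) hGK
      (hball t (Metric.ball_subset_closedBall ht)) v hx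
  -- Compactness of a parameter interval times `K` bounds the derivative by a constant, and `C`
  -- times the indicator of `K` dominates.
  obtain ⟨C, hC⟩ := ((isCompact_closedBall (0 : ℝ) ε).prod hK).exists_bound_of_continuousOn
    (hcont'.mono (prod_mono_right (subset_univ K)))
  have key := hasDerivAt_integral_of_dominated_loc_of_deriv_le (μ := (volume : Measure R3))
    (F := fun t x => G (p + t • v, x)) (F' := fun t x => fderiv ℝ G (p + t • v, x) (v, 0))
    (x₀ := (0 : ℝ)) (bound := K.indicator fun _ => C) (Metric.ball_mem_nhds 0 hε)
    ?_ ?_ ?_ ?_ ?_ ?_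
  · simpa using key.2
  · filter_upwards [Metric.ball_mem_nhds (0 : ℝ) hε] with t ht
    exact (hcont t (Metric.ball_subset_closedBall ht)).aestronglyMeasurable
  · exact (hcont 0 hzero).integrable_of_hasCompactSupport
      (HasCompactSupport.intro hK fun x hx => hGK _ (hball 0 hzero) x hx)
  · refine Continuous.aestronglyMeasurable (continuousOn_univ.1 ?_)
    exact hcont'.comp (f := fun x => ((0 : ℝ), x)) (by fun_prop) fun x _ => ⟨hzero, mem_univ x⟩
  · refine Eventually.of_forall fun x t ht => ?_
    by_cases hx : x ∈ K
    · rw [indicator_of_mem hx]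
      exact hC (t, x) ⟨Metric.ball_subset_closedBall ht, hx⟩
    · rw [indicator_of_notMem hx, hvanish t ht x hx, norm_zero]
  · exact (integrable_indicator_iff hK.measurableSet).2
      (continuousOn_const.integrableOn_compact hK)
  · exact Eventually.of_forall fun x t ht => hd t (Metric.ball_subset_closedBall ht) x

end Parametric

/-! ### Second order expansion of unimodular matrices -/

section Unimodular

variable {E : Type*} [NormedAddCommGroup E] [NormedSpace ℝ E]
  {N : E → Matrix (Fin 3) (Fin 3) ℝ} {q : E}

/-- Jacobi's formula, kept at a general point rather than at `N = 1` because it is differentiated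
once more. -/
theorem fderiv_det_apply (hN : ∀ i j, DifferentiableAt ℝ (fun q => N q i j) q) (v : E) :
    fderiv ℝ (fun q => (N q).det) q v =
      (N q 1 1 * N q 2 2 - N q 1 2 * N q 2 1) * fderiv ℝ (fun q => N q 0 0) q v
      - (N q 1 0 * N q 2 2 - N q 1 2 * N q 2 0) * fderiv ℝ (fun q => N q 0 1) q v
      + (N q 1 0 * N q 2 1 - N q 1 1 * N q 2 0) * fderiv ℝ (fun q => N q 0 2) q v
      - (N q 0 1 * N q 2 2 - N q 0 2 * N q 2 1) * fderiv ℝ (fun q => N q 1 0) q v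
      + (N q 0 0 * N q 2 2 - N q 0 2 * N q 2 0) * fderiv ℝ (fun q => N q 1 1) q v
      - (N q 0 0 * N q 2 1 - N q 0 1 * N q 2 0) * fderiv ℝ (fun q => N q 1 2) q v
      + (N q 0 1 * N q 1 2 - N q 0 2 * N q 1 1) * fderiv ℝ (fun q => N q 2 0) q v
      - (N q 0 0 * N q 1 2 - N q 0 2 * N q 1 0) * fderiv ℝ (fun q => N q 2 1) q v
      + (N q 0 0 * N q 1 1 - N q 0 1 * N q 1 0) * fderiv ℝ (fun q => N q 2 2) q v := by
  simp only [Matrix.det_fin_three]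
  simp (disch := fun_prop) only [fderiv_fun_add, fderiv_fun_sub, fderiv_fun_mul,
    add_apply, sub_apply, smul_apply,
    smul_eq_mul]
  ring

theorem fderiv_frobSq_apply (hN : ∀ i j, DifferentiableAt ℝ (fun q => N q i j) q) (v : E) :
    fderiv ℝ (fun q => frobSq (N q)) q v =
      2 * ∑ i, ∑ j, N q i j * fderiv ℝ (fun q => N q i j) q v := by
  simp only [frobSq, Fin.sum_univ_three, pow_two]
  simp (disch := fun_prop) only [fderiv_fun_add, fderiv_fun_mul,
    add_apply, smul_apply, smul_eq_mul]
  ring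

theorem sum_fderiv_diag_eq_zero (hN : ∀ i j, DifferentiableAt ℝ (fun q => N q i j) q)
    (hdet : ∀ᶠ q in 𝓝 q, (N q).det = 1) (h1 : N q = 1) (v : E) :
    ∑ i, fderiv ℝ (fun q => N q i i) q v = 0 := by
  have h := fderiv_det_apply hN v
  have h0 : fderiv ℝ (fun q => (N q).det) q = 0 := by
    rw [Filter.EventuallyEq.fderiv_eq (f₁ := fun q => (N q).det) (f := fun _ => (1 : ℝ)) hdet]
    simp
  rw [h0, h1] at h
  simpa [Fin.sum_univ_three] using h.symm

/-- This is the second derivative of `det N = 1` at the identity: `tr N_uv + tr N_u tr N_v - tr (N_u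
N_v) = 0`, where the product of traces vanishes. -/
theorem sum_fderiv_fderiv_diag (hN : ∀ i j, ContDiffAt ℝ 2 (fun q => N q i j) q)
    (hdet : ∀ᶠ q in 𝓝 q, (N q).det = 1) (h1 : N q = 1) (u v : E) :
    ∑ i, fderiv ℝ (fun q => fderiv ℝ (fun q => N q i i) q v) q u =
      ∑ i, ∑ j, fderiv ℝ (fun q => N q i j) q u * fderiv ℝ (fun q => N q j i) q v := by
  have hN1 (i j) : DifferentiableAt ℝ (fun q => N q i j) q := (hN i j).differentiableAt (by simp)
  have hev : ∀ᶠ q in 𝓝 q, ∀ i j, DifferentiableAt ℝ (fun q => N q i j) q := by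
    simp only [eventually_all]
    intro i j
    filter_upwards [(hN i j).eventually (by simp)] with q hq using hq.differentiableAt (by simp)
  have hN2 (i j) : DifferentiableAt ℝ (fun q => fderiv ℝ (fun q => N q i j) q v) q :=
    (((hN i j).fderiv_right (m := 1) (by norm_num)).differentiableAt (by simp)).clm_apply
      (differentiableAt_const v)
  have hu := sum_fderiv_diag_eq_zero hN1 hdet h1 u
  have hv := sum_fderiv_diag_eq_zero hN1 hdet h1 v
  have hz : ∀ᶠ q in 𝓝 q, fderiv ℝ (fun q => (N q).det) q v = 0 := by
    filter_upwards [hdet.eventually_nhds] with q hq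
    rw [Filter.EventuallyEq.fderiv_eq (f₁ := fun q => (N q).det) (f := fun _ => (1 : ℝ)) hq]
    simp
  have heq := hev.mono fun q hq => fderiv_det_apply (N := N) hq v
  have hd := congrArg (· u) ((Filter.EventuallyEq.fderiv_eq (𝕜 := ℝ) heq).symm.trans
    (Filter.EventuallyEq.fderiv_eq (f := fun _ => (0 : ℝ)) hz))
  simp (disch := fun_prop) only [fderiv_fun_add, fderiv_fun_sub, fderiv_fun_mul,
    add_apply, sub_apply, smul_apply,
    smul_eq_mul, h1, fderiv_fun_const] at hd
  simp at hd
  simp only [Fin.sum_univ_three] at hu hv ⊢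
  linear_combination hd - (fderiv ℝ (fun q => N q 0 0) q v + fderiv ℝ (fun q => N q 1 1) q v
    + fderiv ℝ (fun q => N q 2 2) q v) * hu

theorem fderiv_frobSq_eq_zero (hN : ∀ i j, DifferentiableAt ℝ (fun q => N q i j) q)
    (hdet : ∀ᶠ q in 𝓝 q, (N q).det = 1) (h1 : N q = 1) (v : E) :
    fderiv ℝ (fun q => frobSq (N q)) q v = 0 := by
  rw [fderiv_frobSq_apply hN, h1]
  simp [Matrix.one_apply, sum_fderiv_diag_eq_zero hN hdet h1]

/-- The product rule gives `2⟨N_u, N_v⟩ + 2 tr N_uv`; trading `tr N_uv` for `tr (N_u N_v)` completes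
the product of symmetrized matrices. -/
theorem fderiv_fderiv_frobSq (hN : ∀ i j, ContDiffAt ℝ 2 (fun q => N q i j) q)
    (hdet : ∀ᶠ q in 𝓝 q, (N q).det = 1) (h1 : N q = 1) (u v : E) :
    fderiv ℝ (fun q => fderiv ℝ (fun q => frobSq (N q)) q v) q u =
      ∑ i, ∑ j, (fderiv ℝ (fun q => N q i j) q u + fderiv ℝ (fun q => N q j i) q u) *
        (fderiv ℝ (fun q => N q i j) q v + fderiv ℝ (fun q => N q j i) q v) := by
  have hN1 (i j) : DifferentiableAt ℝ (fun q => N q i j) q := (hN i j).differentiableAt (by simp)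
  have hev : ∀ᶠ q in 𝓝 q, ∀ i j, DifferentiableAt ℝ (fun q => N q i j) q := by
    simp only [eventually_all]
    intro i j
    filter_upwards [(hN i j).eventually (by simp)] with q hq using hq.differentiableAt (by simp)
  have hN2 (i j) : DifferentiableAt ℝ (fun q => fderiv ℝ (fun q => N q i j) q v) q :=
    (((hN i j).fderiv_right (m := 1) (by norm_num)).differentiableAt (by simp)).clm_apply
      (differentiableAt_const v)
  have heq : (fun q => fderiv ℝ (fun q => frobSq (N q)) q v) =ᶠ[𝓝 q]
      fun q => 2 * ∑ i, ∑ j, N q i j * fderiv ℝ (fun q => N q i j) q v := by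
    filter_upwards [hev] with q hq using fderiv_frobSq_apply hq v
  have htr := sum_fderiv_fderiv_diag hN hdet h1 u v
  rw [heq.fderiv_eq]
  simp only [Fin.sum_univ_three] at htr ⊢
  simp (disch := fun_prop) only [fderiv_fun_add, fderiv_const_mul, fderiv_fun_mul,
    add_apply, smul_apply, smul_eq_mul, h1]
  simp
  linear_combination 2 * htr

end Unimodular

/-! ### The family of inverses of a variation -/

section Family

variable {P : Type} {ψ : P → SDiff}

/-- The Jacobian matrices of the inverses of a family of diffeomorphisms. -/
def invJac (ψ : P → SDiff) (q : P × R3) : Matrix (Fin 3) (Fin 3) ℝ :=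
  jac (fderiv ℝ (ψ q.1).inv q.2)

theorem det_invJac (q : P × R3) : (invJac ψ q).det = 1 := (ψ q.1).det_jac_inv q.2

theorem invJac_eq_one {p : P} {K : Set R3} (hK : IsClosed K) (h : ∀ x ∉ K, ψ p x = x) {x : R3}
    (hx : x ∉ K) : invJac ψ (p, x) = 1 := by
  rw [invJac, fderiv_eq_id_of_forall_notMem hK (fun y hy => (ψ p).inv_eq_self (h y hy)) hx, jac_id]

theorem invJac_zero [Zero P] (h : ∀ x, ψ 0 x = x) (x : R3) : invJac ψ (0, x) = 1 :=
  invJac_eq_one isClosed_empty (fun x _ => h x) (notMem_empty x)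

/-- The energy density of `invStereo ∘ ψ p`, transported to the target of `ψ p` and normalized to
vanish off the support of `ψ p`. -/
def relDensity (ψ : P → SDiff) (q : P × R3) : ℝ := weight q.2 * (frobSq (invJac ψ q) - 3)

theorem toReal_E4_eq_relDensity (p : P) : (E4 (invStereo ∘ ψ p)).toReal =
    6 * (∫ x, weight x) + 2 * ∫ x, relDensity ψ (p, x) :=
  (ψ p).toReal_E4_invStereo_comp

theorem relDensity_eq_zero {p : P} {K : Set R3} (hK : IsClosed K) (h : ∀ x ∉ K, ψ p x = x) {x : R3}
    (hx : x ∉ K) : relDensity ψ (p, x) = 0 := by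
  rw [relDensity, invJac_eq_one hK h hx, frobSq_one, sub_self, mul_zero]

end Family

/-! ### Smooth dependence of the inverses, and first and second variations of the density. -/

section Variation

variable {P : Type} [NormedAddCommGroup P] [NormedSpace ℝ P] {ψ : P → SDiff} {U : Set P}

/-- The inverse function theorem is applied to `Φ(p, x) = (p, ψ_p(x))`, whose inverse has `ψ_p⁻¹` as
second component. -/
theorem contDiffAt_inv_family [CompleteSpace P] (hU : IsOpen U)
    (hψ : ContDiffOn ℝ ∞ (fun q : P × R3 => ψ q.1 q.2) (U ×ˢ univ)) {p : P} (hp : p ∈ U) (y : R3) :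
    ContDiffAt ℝ ∞ (fun q : P × R3 => (ψ q.1).inv q.2) (p, y) := by
  set x := (ψ p).inv y with hx
  have hΨ : ContDiffAt ℝ ∞ (fun q : P × R3 => ψ q.1 q.2) (p, x) :=
    hψ.contDiffAt ((hU.prod isOpen_univ).mem_nhds ⟨hp, mem_univ x⟩)
  have hΨd := (hΨ.differentiableAt (by simp)).hasFDerivAt
  set D := fderiv ℝ (fun q : P × R3 => ψ q.1 q.2) (p, x)
  have hD (w : R3) : D (0, w) = fderiv ℝ (ψ p) x w :=
    (congrArg (· w) (hΨd.comp x (hasFDerivAt_prodMk_right p x)).fderiv).symm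
  set B := fderiv ℝ (ψ p).inv y
  have hψd := ((ψ p).contDiff.differentiable (by simp) x).hasFDerivAt
  have hBd : HasFDerivAt (ψ p).inv B y :=
    ((ψ p).contDiff_inv.differentiable (by simp) y).hasFDerivAt
  have hxy : ψ p x = y := (ψ p).apply_inv y
  have hBD (w : R3) : B (D (0, w)) = w := by
    rw [hD]
    have h := HasFDerivAt.comp (g := (ψ p).inv) (g' := B) x (by rwa [hxy]) hψd
    have h' : HasFDerivAt ((ψ p).inv ∘ ψ p) (ContinuousLinearMap.id ℝ R3) x := by
      rw [show (ψ p).inv ∘ ψ p = id from funext (ψ p).inv_apply]; exact hasFDerivAt_id x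
    exact congrArg (· w) (h.unique h')
  have hDB (w : R3) : D (0, B w) = w := by
    rw [hD]
    have h := hψd.comp y hBd
    have h' : HasFDerivAt ((ψ p : R3 → R3) ∘ (ψ p).inv) (ContinuousLinearMap.id ℝ R3) y := by
      rw [show (ψ p : R3 → R3) ∘ (ψ p).inv = id from funext (ψ p).apply_inv]
      exact hasFDerivAt_id y
    exact congrArg (· w) (h.unique h')
  have hsplit (u : P) (w : R3) : D (u, w) = D (u, 0) + D (0, w) := by
    rw [← map_add]; simp
  -- `DΦ` is block triangular; it is inverted by subtracting the parameter contribution and then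
  -- applying `B = Dψ_p⁻¹`.
  let L : (P × R3) ≃L[ℝ] (P × R3) := ContinuousLinearEquiv.equivOfInverse
    ((ContinuousLinearMap.fst ℝ P R3).prod D)
    ((ContinuousLinearMap.fst ℝ P R3).prod
      (B.comp (ContinuousLinearMap.snd ℝ P R3 - D.comp ((ContinuousLinearMap.inl ℝ P R3).comp
        (ContinuousLinearMap.fst ℝ P R3)))))
    (by
      rintro ⟨u, w⟩
      simp [hsplit u w, hBD])
    (by
      rintro ⟨u, w⟩
      simp only [ContinuousLinearMap.prod_apply, ContinuousLinearMap.comp_apply,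
        sub_apply, ContinuousLinearMap.coe_fst', ContinuousLinearMap.coe_snd',
        ContinuousLinearMap.inl_apply]
      rw [hsplit, hDB]
      simp)
  let Φ : P × R3 → P × R3 := fun q => (q.1, ψ q.1 q.2)
  have hΦ : ContDiffAt ℝ ∞ Φ (p, x) := contDiffAt_fst.prodMk hΨ
  have hΦd : HasFDerivAt Φ (L : P × R3 →L[ℝ] P × R3) (p, x) := hasFDerivAt_fst.prodMk hΨd
  have hsmooth := hΦ.to_localInverse hΦd (by simp)
  have hright := (hΦ.hasStrictFDerivAt' hΦd (by simp)).eventually_right_inverse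
  have hΦx : Φ (p, x) = (p, y) := by simp only [Φ, hxy]
  rw [hΦx] at hsmooth hright
  refine (contDiffAt_snd.comp _ hsmooth).congr_of_eventuallyEq ?_
  -- The local inverse is only a right inverse of `Φ` near the point; injectivity of `ψ_p`
  -- identifies its second component with `ψ_p⁻¹`.
  filter_upwards [hright] with z hz
  have hz1 := congrArg Prod.fst hz
  have hz2 := congrArg Prod.snd hz
  simp only [Φ] at hz1 hz2
  rw [hz1] at hz2
  rw [← hz2, (ψ z.1).inv_apply]
  rfl

theorem invJac_apply {p : P} {y : R3}
    (hχ : ContDiffAt ℝ ∞ (fun q : P × R3 => (ψ q.1).inv q.2) (p, y)) (i j : Fin 3) :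
    invJac ψ (p, y) i j =
      fderiv ℝ (fun q : P × R3 => (ψ q.1).inv q.2) (p, y) (0, e j) i := by
  have h := (hχ.differentiableAt (by simp)).hasFDerivAt.comp y
    (hasFDerivAt_prodMk_right p y)
  have h' := congrArg (· (e j)) h.fderiv
  exact congrArg (fun z : R3 => z i) h'

theorem contDiffAt_invJac (hU : IsOpen U)
    (hχ : ∀ p ∈ U, ∀ y, ContDiffAt ℝ ∞ (fun q : P × R3 => (ψ q.1).inv q.2) (p, y))
    {p : P} (hp : p ∈ U) (y : R3) (i j : Fin 3) :
    ContDiffAt ℝ ∞ (fun q => invJac ψ q i j) (p, y) := by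
  have h : ContDiffAt ℝ ∞
      (fun q => fderiv ℝ (fun q : P × R3 => (ψ q.1).inv q.2) q (0, e j) i) (p, y) :=
    contDiffAt_euclidean.1 (((hχ p hp y).fderiv_right (m := ∞) (by simp)).clm_apply
      contDiffAt_const) i
  refine h.congr_of_eventuallyEq ?_
  filter_upwards [(hU.prod isOpen_univ).mem_nhds ⟨hp, mem_univ y⟩] with q hq
  exact invJac_apply (hχ q.1 hq.1 q.2) i j

/-- The first order variation of the inverse of `ψ` is minus that of `ψ`. -/
theorem fderiv_inv_family_zero (h0U : (0 : P) ∈ U) (h0 : ∀ x, ψ 0 x = x)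
    (hχ : ∀ p ∈ U, ∀ y, ContDiffAt ℝ ∞ (fun q : P × R3 => (ψ q.1).inv q.2) (p, y))
    {v : P} {X : R3 → R3} (hX : ∀ x, HasDerivAt (fun t : ℝ => ψ (t • v) x) (X x) 0) (y : R3) :
    fderiv ℝ (fun q : P × R3 => (ψ q.1).inv q.2) (0, y) (v, 0) = -X y := by
  have hd := ((hχ 0 h0U y).differentiableAt (by simp)).hasFDerivAt
  set D := fderiv ℝ (fun q : P × R3 => (ψ q.1).inv q.2) (0, y)
  have hcurve : HasDerivAt (fun t : ℝ => (t • v, ψ (t • v) y)) (v, X y) 0 := by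
    have h := (hasDerivAt_id (0 : ℝ)).smul_const v
    simp only [one_smul] at h
    exact h.prodMk (hX y)
  -- Differentiate the identity `ψ_{tv}⁻¹(ψ_{tv}(y)) = y` at `t = 0`.
  have h1 : D (v, X y) = 0 := by
    have hd' : HasFDerivAt (fun q : P × R3 => (ψ q.1).inv q.2) D
        ((0 : ℝ) • v, ψ ((0 : ℝ) • v) y) := by
      rw [zero_smul, h0]; exact hd
    have h := HasFDerivAt.comp_hasDerivAt (𝕜 := ℝ) 0 hd' hcurve
    refine h.unique ((hasDerivAt_const (0 : ℝ) y).congr_of_eventuallyEq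
      (Eventually.of_forall fun t => ?_))
    exact (ψ (t • v)).inv_apply y
  have h2 (w : R3) : D (0, w) = w := by
    have h := hd.comp y (hasFDerivAt_prodMk_right 0 y)
    have h' : HasFDerivAt ((fun q : P × R3 => (ψ q.1).inv q.2) ∘ fun x => (0, x))
        (ContinuousLinearMap.id ℝ R3) y := by
      rw [show ((fun q : P × R3 => (ψ q.1).inv q.2) ∘ fun x => (0, x)) = id from
        funext fun x => (ψ 0).inv_eq_self (h0 x)]
      exact hasFDerivAt_id y
    exact congrArg (· w) (h.unique h')
  have h3 : D (v, X y) = D (v, 0) + D (0, X y) := by rw [← map_add]; simp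
  rw [h1, h2] at h3
  exact eq_neg_of_add_eq_zero_left h3.symm

/-- Mixed partials commute, so the parameter derivative of the Jacobian is the Jacobian of the first
variation `-X`. -/
theorem fderiv_invJac_zero (hU : IsOpen U) (h0U : (0 : P) ∈ U) (h0 : ∀ x, ψ 0 x = x)
    (hχ : ∀ p ∈ U, ∀ y, ContDiffAt ℝ ∞ (fun q : P × R3 => (ψ q.1).inv q.2) (p, y))
    {v : P} {X : R3 → R3} (hX : ∀ x, HasDerivAt (fun t : ℝ => ψ (t • v) x) (X x) 0) (y : R3)
    (i j : Fin 3) :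
    fderiv ℝ (fun q => invJac ψ q i j) (0, y) (v, 0) = -jac (fderiv ℝ X y) i j := by
  set χ : P × R3 → R3 := fun q => (ψ q.1).inv q.2
  have hd2 : DifferentiableAt ℝ (fderiv ℝ χ) (0, y) :=
    ((hχ 0 h0U y).fderiv_right (m := 1) (by norm_cast)).differentiableAt (by simp)
  have heq : (fun q => invJac ψ q i j) =ᶠ[𝓝 (0, y)]
      fun q => (EuclideanSpace.proj i : R3 →L[ℝ] ℝ) (fderiv ℝ χ q (0, e j)) := by
    filter_upwards [(hU.prod isOpen_univ).mem_nhds ⟨h0U, mem_univ y⟩] with q hq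
    exact invJac_apply (hχ q.1 hq.1 q.2) i j
  have h1 : HasFDerivAt (fun q => fderiv ℝ χ q (0, e j))
      ((fderiv ℝ (fderiv ℝ χ) (0, y)).flip (0, e j)) (0, y) := by
    simpa using hd2.hasFDerivAt.clm_apply (hasFDerivAt_const ((0, e j) : P × R3) (0, y))
  have h2 : HasFDerivAt (fun q => fderiv ℝ χ q (v, 0))
      ((fderiv ℝ (fderiv ℝ χ) (0, y)).flip (v, 0)) (0, y) := by
    simpa using hd2.hasFDerivAt.clm_apply (hasFDerivAt_const ((v, 0) : P × R3) (0, y))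
  have hsymm : fderiv ℝ (fderiv ℝ χ) (0, y) (v, 0) (0, e j) =
      fderiv ℝ (fderiv ℝ χ) (0, y) (0, e j) (v, 0) :=
    (hχ 0 h0U y).isSymmSndFDerivAt (by simp; norm_cast) _ _
  have h3 := h2.comp y (hasFDerivAt_prodMk_right 0 y)
  have h4 : ((fun q => fderiv ℝ χ q (v, 0)) ∘ fun x => (0, x)) = -X :=
    funext fun x => fderiv_inv_family_zero h0U h0 hχ hX x
  rw [h4] at h3
  have h5 := congrArg (· (e j)) h3.fderiv
  rw [fderiv_neg] at h5
  have h7 := ((EuclideanSpace.proj i : R3 →L[ℝ] ℝ).hasFDerivAt.comp _ h1).fderiv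
  rw [heq.fderiv_eq]
  refine (congrArg (· ((v, 0) : P × R3)) h7).trans ?_
  have h6 : -(fderiv ℝ X y (e j)) = fderiv ℝ (fderiv ℝ χ) (0, y) (0, e j) (v, 0) := h5
  simp only [ContinuousLinearMap.comp_apply, ContinuousLinearMap.flip_apply]
  rw [hsymm, ← h6]
  simp [jac]

theorem contDiffAt_frobSq_invJac (hU : IsOpen U)
    (hχ : ∀ p ∈ U, ∀ y, ContDiffAt ℝ ∞ (fun q : P × R3 => (ψ q.1).inv q.2) (p, y))
    {p : P} (hp : p ∈ U) (y : R3) : ContDiffAt ℝ ∞ (fun q => frobSq (invJac ψ q)) (p, y) :=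
  ContDiffAt.sum fun i _ => ContDiffAt.sum fun j _ => (contDiffAt_invJac hU hχ hp y i j).pow 2

theorem contDiffAt_relDensity (hU : IsOpen U)
    (hχ : ∀ p ∈ U, ∀ y, ContDiffAt ℝ ∞ (fun q : P × R3 => (ψ q.1).inv q.2) (p, y))
    {p : P} (hp : p ∈ U) (y : R3) : ContDiffAt ℝ ∞ (relDensity ψ) (p, y) :=
  (contDiff_weight.contDiffAt.comp (p, y) contDiffAt_snd).mul
    ((contDiffAt_frobSq_invJac hU hχ hp y).sub contDiffAt_const)

theorem fderiv_weight_mul_apply {F : P × R3 → ℝ} {q : P × R3} (hF : DifferentiableAt ℝ F q)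
    (v : P) : fderiv ℝ (fun q : P × R3 => weight q.2 * F q) q (v, 0) =
      weight q.2 * fderiv ℝ F q (v, 0) := by
  have hw : HasFDerivAt (fun q : P × R3 => weight q.2)
      ((fderiv ℝ weight q.2).comp (ContinuousLinearMap.snd ℝ P R3)) q :=
    ((contDiff_weight (n := 1)).differentiable (by simp) q.2).hasFDerivAt.comp q hasFDerivAt_snd
  refine (congrArg (· ((v, 0) : P × R3)) (hw.mul hF.hasFDerivAt).fderiv).trans ?_
  simp

theorem fderiv_relDensity_apply (hU : IsOpen U)
    (hχ : ∀ p ∈ U, ∀ y, ContDiffAt ℝ ∞ (fun q : P × R3 => (ψ q.1).inv q.2) (p, y))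
    {q : P × R3} (hq : q.1 ∈ U) (v : P) : fderiv ℝ (relDensity ψ) q (v, 0) =
      weight q.2 * fderiv ℝ (fun q => frobSq (invJac ψ q)) q (v, 0) := by
  have h : DifferentiableAt ℝ (fun q => frobSq (invJac ψ q)) q :=
    (contDiffAt_frobSq_invJac hU hχ hq q.2).differentiableAt (by simp)
  rw [← fderiv_sub_const (f := fun q => frobSq (invJac ψ q)) (3 : ℝ)]
  exact fderiv_weight_mul_apply (h.sub_const 3) v

theorem hasDerivAt_toReal_E4 (hU : IsOpen U)
    (hχ : ∀ p ∈ U, ∀ y, ContDiffAt ℝ ∞ (fun q : P × R3 => (ψ q.1).inv q.2) (p, y))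
    {K : Set R3} (hK : IsCompact K) (hψK : ∀ p ∈ U, ∀ x ∉ K, ψ p x = x) {p : P} (hp : p ∈ U)
    (v : P) : HasDerivAt (fun t : ℝ => (E4 (invStereo ∘ ψ (p + t • v))).toReal)
      (2 * ∫ x, fderiv ℝ (relDensity ψ) (p, x) (v, 0)) 0 := by
  simp only [toReal_E4_eq_relDensity]
  exact ((hasDerivAt_integral_of_contDiffAt hU hK
    (fun p hp x => (contDiffAt_relDensity hU hχ hp x).of_le (by norm_cast))
    (fun p hp x hx => relDensity_eq_zero hK.isClosed (hψK p hp) hx) hp v).const_mul 2).const_add _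

/-- Criticality holds pointwise, with no integration by parts. -/
theorem fderiv_relDensity_zero (hU : IsOpen U) (h0U : (0 : P) ∈ U) (h0 : ∀ x, ψ 0 x = x)
    (hχ : ∀ p ∈ U, ∀ y, ContDiffAt ℝ ∞ (fun q : P × R3 => (ψ q.1).inv q.2) (p, y)) (v : P)
    (y : R3) : fderiv ℝ (relDensity ψ) (0, y) (v, 0) = 0 := by
  rw [fderiv_relDensity_apply hU hχ h0U, fderiv_frobSq_eq_zero
    (fun i j => (contDiffAt_invJac hU hχ h0U y i j).differentiableAt (by simp))
    (Eventually.of_forall det_invJac) (invJac_zero h0 y), mul_zero]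

/-- The two minus signs from the inverses cancel. No second derivative of `ψ` in the parameter
survives, which makes the hessian independent of the variation. -/
theorem fderiv_fderiv_relDensity_zero (hU : IsOpen U) (h0U : (0 : P) ∈ U) (h0 : ∀ x, ψ 0 x = x)
    (hχ : ∀ p ∈ U, ∀ y, ContDiffAt ℝ ∞ (fun q : P × R3 => (ψ q.1).inv q.2) (p, y))
    {u v : P} {X Y : R3 → R3} (hX : ∀ x, HasDerivAt (fun t : ℝ => ψ (t • u) x) (X x) 0)
    (hY : ∀ x, HasDerivAt (fun t : ℝ => ψ (t • v) x) (Y x) 0) (y : R3) :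
    fderiv ℝ (fun q => fderiv ℝ (relDensity ψ) q (v, 0)) (0, y) (u, 0) =
      weight y * ∑ i, ∑ j, (jac (fderiv ℝ X y) i j + jac (fderiv ℝ X y) j i) *
        (jac (fderiv ℝ Y y) i j + jac (fderiv ℝ Y y) j i) := by
  have heq : (fun q => fderiv ℝ (relDensity ψ) q (v, 0)) =ᶠ[𝓝 (0, y)]
      fun q => weight q.2 * fderiv ℝ (fun q => frobSq (invJac ψ q)) q (v, 0) := by
    filter_upwards [(hU.prod isOpen_univ).mem_nhds ⟨h0U, mem_univ y⟩] with q hq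
    exact fderiv_relDensity_apply hU hχ hq.1 v
  have hd : DifferentiableAt ℝ
      (fun q => fderiv ℝ (fun q => frobSq (invJac ψ q)) q ((v, 0) : P × R3)) (0, y) :=
    (((contDiffAt_frobSq_invJac hU hχ h0U y).fderiv_right (m := 1)
      (by norm_cast)).differentiableAt (by simp)).clm_apply (differentiableAt_const _)
  rw [heq.fderiv_eq, fderiv_weight_mul_apply hd, fderiv_fderiv_frobSq
    (fun i j => (contDiffAt_invJac hU hχ h0U y i j).of_le (by norm_cast))
    (Eventually.of_forall det_invJac) (invJac_zero h0 y)]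
  simp only [fderiv_invJac_zero hU h0U h0 hχ hX, fderiv_invJac_zero hU h0U h0 hχ hY]
  congr 1
  exact Finset.sum_congr rfl fun i _ => Finset.sum_congr rfl fun j _ => by ring

end Variation

theorem isRestrictedCritical_invStereo : IsRestrictedCritical E4 invStereo := by
  refine ⟨isSmoothMap_invStereo, E4_invStereo_ne_top, fun ψ hψ => ?_⟩
  obtain ⟨h0, U, hU, h0U, hsm, K, hK, hψK⟩ := hψ
  have hχ := fun p hp y => contDiffAt_inv_family hU hsm (p := p) hp y
  have h := hasDerivAt_toReal_E4 hU hχ hK hψK h0U 1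
  simpa [fderiv_relDensity_zero hU h0U h0 hχ] using h

/-! ### The hessian -/

/-- The components `(L_X g)(e_i, e_j) = ∂_j X_i + ∂_i X_j`. -/
def strain (X : R3 → R3) (x : R3) (i j : Fin 3) : ℝ :=
  jac (fderiv ℝ X x) i j + jac (fderiv ℝ X x) j i

theorem inner_e_left (i : Fin 3) (v : R3) : inner ℝ (e i) v = v i := by
  rw [e, EuclideanSpace.inner_single_left]; simp

theorem inner_e_right (i : Fin 3) (v : R3) : inner ℝ v (e i) = v i := by
  rw [real_inner_comm, inner_e_left]

/-- The metric has constant coefficients and `[X, e_i] = -∂_i X`. -/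
theorem lieDerivative_metric (X : R3 → R3) (x : R3) (i j : Fin 3) :
    lieDerivative X metric x (e i) (e j) = strain X x i j := by
  simp [lieDerivative, metric, VectorField.lieBracket_eq, strain, jac, inner_e_left, inner_e_right]
  ring

theorem continuous_strain (X : Gamma0) (i j : Fin 3) :
    Continuous fun x => strain X x i j := by
  have h : Continuous (fderiv ℝ (X : R3 → R3)) := X.2.1.continuous_fderiv (by simp)
  simp only [strain, jac, Matrix.of_apply]
  fun_prop

theorem strain_add (X Y : Gamma0) (x : R3) (i j : Fin 3) :
    strain (X + Y : Gamma0) x i j = strain X x i j + strain Y x i j := by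
  simp only [strain, jac, Matrix.of_apply, Submodule.coe_add]
  rw [fderiv_add (X.2.1.differentiable (by simp) x) (Y.2.1.differentiable (by simp) x)]
  simp
  ring

theorem strain_smul (c : ℝ) (X : Gamma0) (x : R3) (i j : Fin 3) :
    strain (c • X : Gamma0) x i j = c * strain X x i j := by
  simp only [strain, jac, Matrix.of_apply, Submodule.coe_smul]
  rw [fderiv_const_smul (X.2.1.differentiable (by simp) x)]
  simp
  ring

theorem integrable_hessian_density (X Y : Gamma0) :
    Integrable fun x => weight x * ∑ i, ∑ j, strain X x i j * strain Y x i j := by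
  refine Continuous.integrable_of_hasCompactSupport ?_
    (HasCompactSupport.intro X.2.2.1 fun x hx => ?_)
  · exact (contDiff_weight (n := 0)).continuous.mul (continuous_finsetSum _ fun i _ =>
      continuous_finsetSum _ fun j _ => (continuous_strain X i j).mul (continuous_strain Y i j))
  · have h : fderiv ℝ (X : R3 → R3) x = 0 :=
      image_eq_zero_of_notMem_tsupport fun h => hx (tsupport_fderiv_subset ℝ h)
    simp [strain, jac, h]

/-- The hessian of `E₄` at inverse stereographic projection. -/
def hessianE4 : LinearMap.BilinForm ℝ Gamma0 :=
  LinearMap.mk₂ ℝ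
    (fun X Y => 2 * ∫ x, weight x * ∑ i, ∑ j, strain X x i j * strain Y x i j)
    (fun X X' Y => by
      rw [← mul_add, ← integral_add (integrable_hessian_density X Y)
        (integrable_hessian_density X' Y)]
      simp only [strain_add, add_mul, Finset.sum_add_distrib, mul_add])
    (fun c X Y => by
      simp only [strain_smul, mul_assoc, ← Finset.mul_sum, mul_left_comm _ c, integral_const_mul,
        smul_eq_mul])
    (fun X Y Y' => by
      rw [← mul_add, ← integral_add (integrable_hessian_density X Y)
        (integrable_hessian_density X Y')]
      simp only [strain_add, mul_add, Finset.sum_add_distrib])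
    (fun c X Y => by
      simp only [strain_smul, ← Finset.mul_sum, mul_left_comm _ c, integral_const_mul,
        smul_eq_mul])

theorem hessianE4_apply (X Y : Gamma0) :
    hessianE4 X Y = 2 * ∫ x, weight x * ∑ i, ∑ j, strain X x i j * strain Y x i j := rfl

theorem isHessian_hessianE4 : IsHessian E4 invStereo hessianE4 := by
  rintro X Y ψ ⟨h0, U, hU, h0U, hsm, K, hK, hψK⟩ hXY
  have hχ := fun p hp y => contDiffAt_inv_family hU hsm (p := p) hp y
  have hX (x) : HasDerivAt (fun t : ℝ => ψ (t • (1, 0)) x) ((X : R3 → R3) x) 0 := by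
    simpa using (hXY x).1
  have hY (x) : HasDerivAt (fun t : ℝ => ψ (t • (0, 1)) x) ((Y : R3 → R3) x) 0 := by
    simpa using (hXY x).2
  have hev : ∀ᶠ s in 𝓝 (0 : ℝ), (s, (0 : ℝ)) ∈ U :=
    (Continuous.prodMk_left (0 : ℝ)).continuousAt.preimage_mem_nhds (hU.mem_nhds h0U)
  have h1 : ∀ᶠ s in 𝓝 (0 : ℝ), HasDerivAt (fun t => (E4 (invStereo ∘ ψ (s, t))).toReal)
      (2 * ∫ x, fderiv ℝ (relDensity ψ) ((s, 0), x) ((0, 1), 0)) 0 := by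
    filter_upwards [hev] with s hs
    simpa using hasDerivAt_toReal_E4 hU hχ hK hψK hs (0, 1)
  refine ⟨h1.mono fun s hs => hs.differentiableAt, ?_⟩
  -- Second differentiation under the integral, now in the `s` direction, of the `t`-derivative of
  -- the density.
  have h2 := hasDerivAt_integral_of_contDiffAt hU hK
    (G := fun q => fderiv ℝ (relDensity ψ) q ((0, 1), 0))
    (fun p hp x => ((contDiffAt_relDensity hU hχ hp x).fderiv_right (m := 1)
      (by norm_cast)).clm_apply contDiffAt_const)
    (fun p hp x hx => fderiv_apply_eq_zero_of_notMem hU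
      (fun p hp x => (contDiffAt_relDensity hU hχ hp x).differentiableAt (by simp))
      (fun p hp x hx => relDensity_eq_zero hK.isClosed (hψK p hp) hx) hp _ hx) h0U (1, 0)
  simp only [fderiv_fderiv_relDensity_zero hU h0U h0 hχ hX hY] at h2
  rw [hessianE4_apply]
  refine (h2.const_mul 2).congr_of_eventuallyEq (h1.mono fun s hs => ?_)
  simp [hs.deriv]

/-! ### The weight in terms of the profile, and positivity of the hessian. -/

theorem deriv_profile_sq (x : R3) : (deriv profile ‖x‖ ^ 2) ^ 2 = weight x := by
  have h : HasDerivAt profile (-(2 * (1 / (1 + ‖x‖ ^ 2)))) ‖x‖ :=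
    ((Real.hasDerivAt_arctan ‖x‖).const_mul 2).const_sub Real.pi
  rw [h.deriv, weight, add_comm, one_div]
  ring

theorem hessianE4_self (X : Gamma0) : hessianE4 X X = 2 * l2NormSq (fun x v w =>
    deriv profile ‖x‖ ^ 2 * lieDerivative X metric x v w) := by
  rw [hessianE4_apply, l2NormSq]
  simp only [lieDerivative_metric, mul_pow _ (strain _ _ _ _), deriv_profile_sq, Finset.mul_sum,
    pow_two (strain _ _ _ _)]

theorem hessianE4_self_nonneg (X : Gamma0) : 0 ≤ hessianE4 X X := by
  rw [hessianE4_self]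
  exact mul_nonneg (by norm_num) (integral_nonneg fun x => Finset.sum_nonneg fun i _ =>
    Finset.sum_nonneg fun j _ => sq_nonneg _)

end Skyrme

end

theorem proposition4p3 :
    Skyrme.IsRestrictedStable Skyrme.E4 Skyrme.invStereo ∧
    ∃ H : LinearMap.BilinForm ℝ Skyrme.Gamma0,
      Skyrme.IsHessian Skyrme.E4 Skyrme.invStereo H ∧
      ∀ X : Skyrme.Gamma0,
        H X X = 2 * Skyrme.l2NormSq (fun x v w =>
          deriv Skyrme.profile ‖x‖ ^ 2 * Skyrme.lieDerivative X Skyrme.metric x v w) :=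
  ⟨⟨Skyrme.isRestrictedCritical_invStereo, Skyrme.hessianE4, Skyrme.isHessian_hessianE4,
    Skyrme.hessianE4_self_nonneg⟩, Skyrme.hessianE4, Skyrme.isHessian_hessianE4,
    Skyrme.hessianE4_self⟩
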